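/- Let $p$ be a prime and let $G$ be a finitely generated uniformly powerful pro-$p$ group; that is, $G$ is a topologically finitely generated pro-$p$ group, $G/\overline{G^p}$ is abelian ($G/\overline{G^4}$ if $p=2$), and $|P_i(G):P_{i+1}(G)|=|G:P_2(G)|$ for all $i\ge 1$, where $P_1(G)=G$ and $P_{i+1}(G)=\overline{P_i(G)^p[P_i(G),G]}$. For $x,y\in G$ and every $n\geq 0$, the element $x^{p^n}y^{p^n}$ has a unique $p^n$-th root in $G$, written $(x^{p^n}y^{p^n})^{p^{-n}}$, and $$x+y=\lim_{n\to\infty}\left(x^{p^n}y^{p^n}\right)^{p^{-n}}$$ exists and makes the set $G$ an abelian group $(G,+)$ (the usual additive structure on $G$). For an automorphism $\alpha$ of a group and an element $g$ put $[g,_0\alpha]=g$ and $[g,_{n+1}\alpha]=h^{-1}\alpha(h)$ with $h=[g,_n\alpha]$ (so $[g,_{n+1}\alpha]=-h+\alpha(h)$ in additive notation). Call $\alpha$ $r$-unipotent if $[g,_r\alpha]$ is the identity element for every element $g$ of the group. Let $r\ge 0$ be an integer. If $\alpha$ is an $r$-unipotent automorphism of $G$ (as an abstract group), then the map $\alpha$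 is also an automorphism of $(G,+)$, and it is an $r$-unipotent automorphism of $(G,+)$. -/

import Mathlib

open Filter Topology

/-- The iterated commutator `[g,ₙ α]` of an element with an automorphism, taken in the holomorph:
`[g,₀ α] = g` and `[g,ₙ₊₁ α] = [[g,ₙ α], α]`, where `[h, α] = h⁻¹ h^α`. In additive notation,
`[h, α] = -h + α h`. -/
@[to_additive /-- The iterated commutator `[g,ₙ α]` of an element with an automorphism of an
additive group: `[g,₀ α] = g` and `[g,ₙ₊₁ α] = [[g,ₙ α], α]`, where `[h, α] = -h + α h`. -/]
def MulEquiv.iterComm {G : Type*} [Group G] (α : G ≃* G) (n : ℕ) (g : G) : G :=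
  (fun h => h⁻¹ * α h)^[n] g

/-- An automorphism `α` is `r`-unipotent if `[g,ᵣ α] = 1` for every `g`. -/
@[to_additive /-- An automorphism `α` of an additive group is `r`-unipotent if `[g,ᵣ α] = 0` for
every `g`. -/]
def MulEquiv.IsUnipotent {G : Type*} [Group G] (r : ℕ) (α : G ≃* G) : Prop :=
  ∀ g, α.iterComm r g = 1

section ProP

variable (p : ℕ) (G : Type*) [Group G] [TopologicalSpace G] [IsTopologicalGroup G]

/-- Pro-`p` groups: profinite groups all of whose open normal subgroups have `p`-power index. -/
structure IsProP : Prop where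
  compact : CompactSpace G
  t2 : T2Space G
  totallyDisconnected : TotallyDisconnectedSpace G
  index_eq : ∀ U : Subgroup G, U.Normal → IsOpen (U : Set G) → ∃ k : ℕ, U.index = p ^ k

/-- Finite generation as a topological group. -/
def IsTopFG : Prop :=
  ∃ S : Finset G, (Subgroup.closure (S : Set G)).topologicalClosure = ⊤

/-- `H ^ n`, the abstract subgroup generated by the `n`-th powers of the elements of `H`. -/
def Subgroup.powers {G : Type*} [Group G] (H : Subgroup G) (n : ℕ) : Subgroup G :=
  Subgroup.closure ((fun x : G => x ^ n) '' (H : Set G))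

/-- Powerful: `G` modulo the closure of `G ^ p` (of `G ^ 4` if `p = 2`) is abelian. -/
def IsPowerful : Prop :=
  commutator G ≤ ((⊤ : Subgroup G).powers (if p = 2 then 4 else p)).topologicalClosure

/-- The lower `p`-series, indexed from `0`: `lowerPSeries p G i` is the group usually denoted by
`P_{i+1}(G)`, so that `P_1(G) = G` and `P_{i+1}(G)` is the closure of `P_i(G)^p [P_i(G), G]`. -/
def lowerPSeries : ℕ → Subgroup G
  | 0 => ⊤
  | i + 1 =>
    ((lowerPSeries i).powers p ⊔ ⁅lowerPSeries i, (⊤ : Subgroup G)⁆).topologicalClosure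

/-- Finitely generated uniformly powerful pro-`p` groups. -/
structure IsUniformlyPowerful : Prop where
  isProP : IsProP p G
  isTopFG : IsTopFG G
  isPowerful : IsPowerful p G
  relIndex_eq : ∀ i : ℕ,
    (lowerPSeries p G (i + 1)).relIndex (lowerPSeries p G i) = (lowerPSeries p G 1).index

end ProP

section AdditiveStructure

variable (p : ℕ) {G : Type*} [Group G] [TopologicalSpace G]

/-- `z` is the limit of the sequence `s n = (x ^ (p ^ n) * y ^ (p ^ n)) ^ (p ^ (-n))`. That is, for
every `n` the element `x ^ (p ^ n) * y ^ (p ^ n)` has exactly one `p ^ n`-th root `s n` in `G`, and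
`s n` converges to `z`. -/
def IsUniformSum (x y z : G) : Prop :=
  ∃ s : ℕ → G,
    (∀ n : ℕ, ∀ w : G, w ^ p ^ n = x ^ p ^ n * y ^ p ^ n ↔ w = s n) ∧
    Tendsto s atTop (𝓝 z)

/-- The abelian group structure `A` on the set `G` is the usual additive structure of the uniformly
powerful group `G`: its addition is `x + y = lim (x ^ (p ^ n) * y ^ (p ^ n)) ^ (p ^ (-n))`. -/
def IsUniformAdditiveStructure (A : AddCommGroup G) : Prop :=
  ∀ x y : G, IsUniformSum p x y (x + y)

end AdditiveStructure

/-!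
Write `H i` for the `i`-th term of the lower `p`-series, indexed from `0`. Everything rests on the
commutator estimate `[H i, H j] ≤ H (i + j + 1)` (`commutator_mem_lowerPSeries_add`), a consequence
of the three subgroups lemma, and on the behaviour of the `p`-th power map with respect to `H`.

Powerfulness makes the `p`-th power map a homomorphism from `H i` to `H (i + 1) / H (i + 2)`, and
more precisely `(x c) ^ p ≡ x ^ p c ^ p` modulo `H (i + 2)` for `x` in `G` and `c` in `H i`
(`mk_mul_pow_eq`). It is surjective (`lowerPSeries_succ_le_range`), and as all the factors
`H i / H (i + 1)` have the same finite order, it induces isomorphisms between successive factors.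
Hence `x ≡ y` modulo `H k` if and only if `x ^ (p ^ n) ≡ y ^ (p ^ n)` modulo `H (k + n)`
(`mk_pow_pow_eq_iff`), and a compactness argument shows that `H n` is exactly the set of
`p ^ n`-th powers (`mem_lowerPSeries_iff`), each with a unique root.

Since `p ^ n`-th powers commute modulo `H (2n + 1)`, the roots of `x ^ (p ^ n) y ^ (p ^ n)` form a
Cauchy sequence, and its limit `z` is characterised by `z ^ (p ^ n) ≡ x ^ (p ^ n) y ^ (p ^ n)` modulo
`H (2n)` for all `n` (`IsPowerSum`, `isUniformSum_iff_isPowerSum`). In this form the abelian group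
axioms are immediate.

An abstract automorphism `α` preserves each `H n`, which is a set of powers, so it preserves the
congruences and is additive. The same congruences show by induction that the `p ^ n`-th power of the
additive iterated commutator of `g` with `α` agrees modulo `H (2n)` with the iterated commutator of
`g ^ (p ^ n)` with `α` in the group (`mk_iterComm_pow_eq`). If `α` is `r`-unipotent, the latter is
trivial after `r` steps, so the `r`-th additive commutator of `g` lies in `H n` for all `n`, and it
vanishes because the `H n` form a neighbourhood basis of `1`.
-/

open scoped commutatorElement

/-! ### Commutators and powers in the lower `p`-series -/

theorem Subgroup.powers_normal {G : Type*} [Group G] (H : Subgroup G) [H.Normal] (n : ℕ) :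
    (H.powers n).Normal := by
  refine ⟨fun x hx g => ?_⟩
  have hle : H.powers n ≤ (H.powers n).comap (MulAut.conj g).toMonoidHom := by
    rw [Subgroup.powers, Subgroup.closure_le]
    rintro _ ⟨y, hy, rfl⟩
    refine Subgroup.subset_closure ⟨g * y * g⁻¹, Subgroup.Normal.conj_mem inferInstance y hy g, ?_⟩
    simp
  exact hle hx

section LowerPSeries

variable {p : ℕ} {G : Type*} [Group G] [TopologicalSpace G] [IsTopologicalGroup G]

instance lowerPSeries_normal (i : ℕ) : (lowerPSeries p G i).Normal := by
  induction i with
  | zero => exact inferInstanceAs (⊤ : Subgroup G).Normal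
  | succ i ih =>
    have := (lowerPSeries p G i).powers_normal p
    exact Subgroup.is_normal_topologicalClosure _

theorem isClosed_lowerPSeries (i : ℕ) : IsClosed (lowerPSeries p G i : Set G) := by
  cases i with
  | zero => exact isClosed_univ
  | succ i => exact Subgroup.isClosed_topologicalClosure _

theorem pow_mem_lowerPSeries_succ {i : ℕ} {x : G} (hx : x ∈ lowerPSeries p G i) :
    x ^ p ∈ lowerPSeries p G (i + 1) :=
  Subgroup.le_topologicalClosure _
    (Subgroup.mem_sup_left (Subgroup.subset_closure ⟨x, hx, rfl⟩))

theorem commutator_mem_lowerPSeries_succ {i : ℕ} {x : G} (hx : x ∈ lowerPSeries p G i) (g : G) :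
    ⁅x, g⁆ ∈ lowerPSeries p G (i + 1) :=
  Subgroup.le_topologicalClosure _
    (Subgroup.mem_sup_right (Subgroup.commutator_mem_commutator hx (Subgroup.mem_top g)))

theorem pow_pow_mem_lowerPSeries (x : G) (n : ℕ) : x ^ p ^ n ∈ lowerPSeries p G n := by
  induction n with
  | zero => exact Subgroup.mem_top _
  | succ n ih =>
    rw [pow_succ, pow_mul]
    exact pow_mem_lowerPSeries_succ ih

theorem lowerPSeries_succ_le {i : ℕ} {K : Subgroup G} (hK : IsClosed (K : Set G))
    (hpow : ∀ x ∈ lowerPSeries p G i, x ^ p ∈ K)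
    (hcomm : ∀ x ∈ lowerPSeries p G i, ∀ g, ⁅x, g⁆ ∈ K) : lowerPSeries p G (i + 1) ≤ K := by
  refine Subgroup.topologicalClosure_minimal _ (sup_le ?_ ?_) hK
  · rw [Subgroup.powers, Subgroup.closure_le]
    rintro _ ⟨x, hx, rfl⟩
    exact hpow x hx
  · exact Subgroup.commutator_le.2 fun x hx g _ => hcomm x hx g

theorem lowerPSeries_antitone : Antitone (lowerPSeries p G) := by
  refine antitone_nat_of_succ_le fun i => lowerPSeries_succ_le (isClosed_lowerPSeries i)
    (fun x hx => pow_mem hx p) fun x hx g => ?_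
  exact Subgroup.commutator_le_left _ ⊤ (Subgroup.commutator_mem_commutator hx (Subgroup.mem_top g))

/-- The elements whose commutators with all elements of `H` lie in the normal subgroup `K`. -/
def Subgroup.centralizerMod {G : Type*} [Group G] (H K : Subgroup G) [K.Normal] : Subgroup G :=
  (Subgroup.centralizer ((QuotientGroup.mk' K) '' (H : Set G))).comap (QuotientGroup.mk' K)

theorem Subgroup.mem_centralizerMod {G : Type*} [Group G] {H K : Subgroup G} [K.Normal] {b : G} :
    b ∈ H.centralizerMod K ↔ ∀ a ∈ H, ⁅a, b⁆ ∈ K := by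
  simp only [centralizerMod, mem_comap, mem_centralizer_iff_commutator_eq_one, Set.mem_image,
    SetLike.mem_coe, forall_exists_index, and_imp, forall_apply_eq_imp_iff₂]
  simp only [← map_commutatorElement, ← MonoidHom.mem_ker, QuotientGroup.ker_mk']

theorem Subgroup.isClosed_centralizerMod {H K : Subgroup G} [K.Normal]
    (hK : IsClosed (K : Set G)) : IsClosed (H.centralizerMod K : Set G) := by
  have : (H.centralizerMod K : Set G) = ⋂ a ∈ H, {b | ⁅a, b⁆ ∈ K} := by
    ext b
    simp [Subgroup.mem_centralizerMod]
  rw [this]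
  refine isClosed_biInter fun a _ => hK.preimage ?_
  change Continuous fun b => a * b * a⁻¹ * b⁻¹
  fun_prop

theorem commutator_pow_mem_of_commutator_mem {G : Type*} [Group G] {K : Subgroup G} [K.Normal]
    {a b : G} {n : ℕ} (h : ⁅⁅a, b⁆, b⁆ ∈ K) (hn : ⁅a, b⁆ ^ n ∈ K) : ⁅a, b ^ n⁆ ∈ K := by
  rw [← QuotientGroup.ker_mk' K, MonoidHom.mem_ker] at h hn ⊢
  simp only [map_commutatorElement, map_pow] at h hn ⊢
  generalize QuotientGroup.mk' K a = x at *
  generalize QuotientGroup.mk' K b = y at *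
  have hc : Commute ⁅x, y⁆ y := commutatorElement_eq_one_iff_commute.1 h
  have hconj : x * y * x⁻¹ = ⁅x, y⁆ * y := by simp [commutatorElement_def]
  rw [commutatorElement_def, ← conj_pow, hconj, hc.mul_pow, hn]
  simp

/-- The three subgroups lemma modulo a normal subgroup. -/
theorem Subgroup.commutator_commutator_le_of_rotate {G : Type*} [Group G]
    {H₁ H₂ H₃ K : Subgroup G} [K.Normal]
    (h1 : ⁅⁅H₂, H₃⁆, H₁⁆ ≤ K) (h2 : ⁅⁅H₃, H₁⁆, H₂⁆ ≤ K) : ⁅⁅H₁, H₂⁆, H₃⁆ ≤ K := by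
  rw [← QuotientGroup.ker_mk' K, ← Subgroup.map_eq_bot_iff] at h1 h2 ⊢
  simp only [Subgroup.map_commutator] at h1 h2 ⊢
  exact Subgroup.commutator_commutator_eq_bot_of_rotate h1 h2

theorem commutator_mem_lowerPSeries_add {i j : ℕ} {a b : G} (ha : a ∈ lowerPSeries p G i)
    (hb : b ∈ lowerPSeries p G j) : ⁅a, b⁆ ∈ lowerPSeries p G (i + j + 1) := by
  suffices h : ∀ j i, ∀ a ∈ lowerPSeries p G i, ∀ b ∈ lowerPSeries p G j,
      ⁅a, b⁆ ∈ lowerPSeries p G (i + j + 1) from h j i a ha b hb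
  clear! a b i j
  intro j
  induction j with
  | zero => exact fun i a ha b _ => commutator_mem_lowerPSeries_succ ha b
  | succ j ih =>
    intro i a ha b hb
    refine Subgroup.mem_centralizerMod.1 (lowerPSeries_succ_le (p := p)
      (Subgroup.isClosed_centralizerMod (isClosed_lowerPSeries _)) (fun b hb => ?_)
      (fun b hb g => ?_) hb) a ha
    · exact Subgroup.mem_centralizerMod.2 fun a ha => commutator_pow_mem_of_commutator_mem
        (commutator_mem_lowerPSeries_succ (ih i a ha b hb) _)
        (pow_mem_lowerPSeries_succ (ih i a ha b hb))
    · refine Subgroup.mem_centralizerMod.2 fun a ha => ?_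
      have key : ⁅⁅lowerPSeries p G j, (⊤ : Subgroup G)⁆, lowerPSeries p G i⁆ ≤
          lowerPSeries p G (i + (j + 1) + 1) := by
        refine Subgroup.commutator_commutator_le_of_rotate ?_ ?_
        · have h1 : ⁅(⊤ : Subgroup G), lowerPSeries p G i⁆ ≤ lowerPSeries p G (i + 1) := by
            rw [Subgroup.commutator_comm, Subgroup.commutator_le]
            exact fun x hx g _ => commutator_mem_lowerPSeries_succ hx g
          refine (Subgroup.commutator_mono h1 le_rfl).trans (Subgroup.commutator_le.2 ?_)
          intro x hx y hy
          have := ih (i + 1) x hx y hy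
          rwa [show i + (j + 1) + 1 = i + 1 + j + 1 by omega]
        · refine (Subgroup.commutator_mono (Subgroup.commutator_le.2 (ih i)) le_rfl).trans ?_
          exact Subgroup.commutator_le.2 fun x hx g _ => commutator_mem_lowerPSeries_succ hx g
      rw [Subgroup.commutator_comm] at key
      exact key (Subgroup.commutator_mem_commutator ha
        (Subgroup.commutator_mem_commutator hb (Subgroup.mem_top g)))

/-- For `p = 2`, commutators with elements of a powerful group drop two steps in the lower
`2`-series. -/
theorem commutator_mem_lowerPSeries_add_two (hp : p = 2) (h : IsPowerful p G) {i : ℕ} {a : G}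
    (ha : a ∈ lowerPSeries p G i) (g : G) : ⁅a, g⁆ ∈ lowerPSeries p G (i + 2) := by
  subst hp
  suffices hi : ∀ i, ∀ b ∈ lowerPSeries 2 G i, ∀ a ∈ (⊤ : Subgroup G),
      ⁅a, b⁆ ∈ lowerPSeries 2 G (i + 2) by
    rw [← commutatorElement_inv, inv_mem_iff]
    exact hi i a ha g (Subgroup.mem_top g)
  clear! i a g
  intro i
  induction i with
  | zero =>
    intro b hb a ha
    have hab := h (Subgroup.commutator_mem_commutator ha (Subgroup.mem_top b))
    refine Subgroup.topologicalClosure_minimal _ ?_ (isClosed_lowerPSeries _) hab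
    rw [Subgroup.powers, Subgroup.closure_le]
    rintro _ ⟨x, -, rfl⟩
    have h1 : x ^ 2 ∈ lowerPSeries 2 G 1 := pow_mem_lowerPSeries_succ (Subgroup.mem_top x)
    have h2 : (x ^ 2) ^ 2 ∈ lowerPSeries 2 G 2 := pow_mem_lowerPSeries_succ h1
    simpa [← pow_mul] using h2
  | succ i ih =>
    intro b hb
    refine Subgroup.mem_centralizerMod.1 (lowerPSeries_succ_le (p := 2)
      (Subgroup.isClosed_centralizerMod (isClosed_lowerPSeries _)) (fun b hb => ?_)
      (fun b hb g => ?_) hb)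
    · exact Subgroup.mem_centralizerMod.2 fun a ha => commutator_pow_mem_of_commutator_mem
        (commutator_mem_lowerPSeries_succ (ih b hb a ha) _)
        (pow_mem_lowerPSeries_succ (ih b hb a ha))
    · refine Subgroup.mem_centralizerMod.2 fun a ha => ?_
      rw [← commutatorElement_inv, inv_mem_iff]
      refine commutator_mem_lowerPSeries_succ ?_ a
      rw [← commutatorElement_inv, inv_mem_iff]
      exact ih b hb g (Subgroup.mem_top g)

/-- The collection formula in nilpotency class two: `t` is the commutator `c⁻¹ x⁻¹ c x`. -/
theorem mul_pow_eq_of_commute {G : Type*} [Group G] {x c t : G} (h : c * x = x * c * t)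
    (hx : Commute t x) (hc : Commute t c) (n : ℕ) :
    (x * c) ^ n = x ^ n * c ^ n * t ^ n.choose 2 := by
  have hcx : ∀ n : ℕ, c ^ n * x = x * c ^ n * t ^ n := by
    intro n
    induction n with
    | zero => simp
    | succ n ih =>
      calc c ^ (n + 1) * x = c ^ n * (c * x) := by rw [pow_succ, mul_assoc]
        _ = c ^ n * x * c * t := by rw [h]; simp only [mul_assoc]
        _ = x * c ^ n * (t ^ n * c) * t := by rw [ih]; simp only [mul_assoc]
        _ = x * c ^ (n + 1) * t ^ (n + 1) := by
          rw [(hc.pow_left n).eq, pow_succ c, pow_succ t]; simp only [mul_assoc]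
  induction n with
  | zero => simp
  | succ n ih =>
    calc (x * c) ^ (n + 1) = x ^ n * c ^ n * (t ^ n.choose 2 * (x * c)) := by
          rw [pow_succ, ih]; simp only [mul_assoc]
      _ = x ^ n * (c ^ n * x) * c * t ^ n.choose 2 := by
          rw [((hx.mul_right hc).pow_left _).eq]; simp only [mul_assoc]
      _ = x ^ n * x * c ^ n * (t ^ n * c) * t ^ n.choose 2 := by
          rw [hcx]; simp only [mul_assoc]
      _ = x ^ (n + 1) * c ^ (n + 1) * t ^ (n + 1).choose 2 := by
          rw [(hc.pow_left n).eq, pow_succ x n, pow_succ c n, Nat.choose_succ_succ' n 1,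
            Nat.choose_one_right, pow_add t]
          simp only [mul_assoc]

/-- In a powerful group, `(x c) ^ p ≡ x ^ p c ^ p` to second order in `c`. The error in the
collection formula is `t ^ (p choose 2)` with `t` a commutator of `c`: for odd `p` the exponent is
divisible by `p`, and for `p = 2` the commutator `t` itself already lies two steps down. -/
theorem mk_mul_pow_eq (hp : p.Prime) (h : IsPowerful p G) {i : ℕ} {c : G}
    (hc : c ∈ lowerPSeries p G i) (x : G) :
    (((x * c) ^ p : G) : G ⧸ lowerPSeries p G (i + 2)) = ((x ^ p * c ^ p : G) : G ⧸ _) := by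
  let π := QuotientGroup.mk' (lowerPSeries p G (i + 2))
  have hπ : ∀ y : G, y ∈ lowerPSeries p G (i + 2) → π y = 1 := fun y hy =>
    (QuotientGroup.eq_one_iff y).2 hy
  have hmem : ⁅c⁻¹, x⁻¹⁆ ∈ lowerPSeries p G (i + 1) :=
    commutator_mem_lowerPSeries_succ (inv_mem hc) _
  have hcomm : ∀ y, Commute (π ⁅c⁻¹, x⁻¹⁆) (π y) := fun y => by
    rw [← commutatorElement_eq_one_iff_commute, ← map_commutatorElement]
    exact hπ _ (commutator_mem_lowerPSeries_succ hmem y)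
  have hxc : π c * π x = π x * π c * π ⁅c⁻¹, x⁻¹⁆ := by
    simp only [← map_mul]
    congr 1
    simp [commutatorElement_def, mul_assoc]
  have hone : π ⁅c⁻¹, x⁻¹⁆ ^ p.choose 2 = 1 := by
    rcases hp.eq_two_or_odd' with rfl | hodd
    · rw [hπ _ (commutator_mem_lowerPSeries_add_two rfl h (inv_mem hc) _), one_pow]
    · obtain ⟨k, hk⟩ : p ∣ p.choose 2 :=
        hp.dvd_choose_self two_ne_zero (hp.two_le.lt_of_ne
          (by rintro rfl; exact absurd hodd (by decide)))
      rw [hk, pow_mul, ← map_pow, hπ _ (pow_mem_lowerPSeries_succ hmem), one_pow]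
  have := mul_pow_eq_of_commute hxc (hcomm x) (hcomm c) p
  rw [hone, mul_one] at this
  change π _ = π _
  simpa only [map_mul, map_pow] using this

end LowerPSeries

/-! ### The topology defined by the lower `p`-series -/

section Topology

variable {p : ℕ} {G : Type*} [Group G] [TopologicalSpace G] [IsTopologicalGroup G]

/-- The first quotient of the lower `p`-series of a topologically finitely generated group is
finite: a dense finitely generated subgroup has finite, hence closed, image in it. -/
theorem index_lowerPSeries_one_ne_zero (hp : 0 < p) (h : IsTopFG G) :
    (lowerPSeries p G 1).index ≠ 0 := by
  obtain ⟨S, hS⟩ := h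
  let N := lowerPSeries p G 1
  let π := QuotientGroup.mk' N
  have hN : IsClosed (N : Set G) := isClosed_lowerPSeries 1
  have hπ : ∀ y : G, y ∈ N → π y = 1 := fun y hy => (QuotientGroup.eq_one_iff y).2 hy
  have hQ : ∀ a b : G ⧸ N, a * b = b * a := by
    intro a b
    obtain ⟨x, rfl⟩ := QuotientGroup.mk'_surjective N a
    obtain ⟨y, rfl⟩ := QuotientGroup.mk'_surjective N b
    refine (commutatorElement_eq_one_iff_mul_comm (g₁ := π x) (g₂ := π y)).1 ?_
    rw [← map_commutatorElement]
    exact hπ _ (commutator_mem_lowerPSeries_succ (Subgroup.mem_top x) y)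
  let _ : CommGroup (G ⧸ N) := { (inferInstance : Group (G ⧸ N)) with mul_comm := hQ }
  let C : Subgroup G := Subgroup.closure (S : Set G)
  let D : Subgroup (G ⧸ N) := C.map π
  have hD : Group.FG D := by
    rw [Group.fg_iff_subgroup_fg]
    classical
    exact ⟨S.image π, by rw [Finset.coe_image, ← MonoidHom.map_closure]⟩
  have htors : IsMulTorsion D := fun d => by
    refine isOfFinOrder_iff_pow_eq_one.2 ⟨p, hp, ?_⟩
    obtain ⟨_, x, hx, rfl⟩ := d
    ext
    rw [Subgroup.coe_pow, ← map_pow]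
    exact hπ _ (pow_mem_lowerPSeries_succ (Subgroup.mem_top x))
  have hfin : Finite D := CommGroup.finite_of_fg_isMulTorsion D htors
  have htop : (D : Set (G ⧸ N)) = Set.univ := by
    have := QuotientGroup.instT3Space N (hN := hN)
    have hcl : IsClosed ((D.comap π : Subgroup G) : Set G) :=
      (Set.toFinite (D : Set (G ⧸ N))).isClosed.preimage QuotientGroup.continuous_mk
    have hle : (⊤ : Subgroup G) ≤ D.comap π :=
      hS ▸ Subgroup.topologicalClosure_minimal _ (Subgroup.le_comap_map π C) hcl
    refine Set.eq_univ_of_forall fun q => ?_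
    obtain ⟨x, rfl⟩ := QuotientGroup.mk'_surjective N q
    exact hle (Subgroup.mem_top x)
  have : Finite (G ⧸ N) := Set.finite_univ_iff.1 (htop ▸ Set.toFinite (D : Set (G ⧸ N)))
  exact Subgroup.index_ne_zero_of_finite

/-- Every open normal subgroup `U` of a pro-`p` group contains a term of the lower `p`-series. By
induction on the index, some term lies in the preimage of a central subgroup of order `p` of
`G ⧸ U`; the next term then lies in `U`. -/
theorem exists_lowerPSeries_le [Fact p.Prime] (h : IsProP p G) (U : Subgroup G) [hU : U.Normal]
    (hUo : IsOpen (U : Set G)) : ∃ i, lowerPSeries p G i ≤ U := by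
  obtain ⟨k, hk⟩ := h.index_eq U hU hUo
  induction k generalizing U with
  | zero => exact ⟨0, by simp_all⟩
  | succ k ih =>
    have hp : p.Prime := Fact.out
    have hcard : Nat.card (G ⧸ U) = p ^ (k + 1) := hk
    have hfin : Finite (G ⧸ U) := Nat.finite_of_card_ne_zero 
      (by rw [hcard]; exact pow_ne_zero _ hp.ne_zero)
    have hnt : Nontrivial (G ⧸ U) := by
      rw [← Finite.one_lt_card_iff_nontrivial, hcard]
      exact Nat.one_lt_pow (by omega) hp.one_lt
    have hpg : IsPGroup p (G ⧸ U) := IsPGroup.of_card hcard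
    have hcnt := hpg.center_nontrivial
    -- `z` generates a central subgroup of order `p` in the finite `p`-group `G ⧸ U`.
    obtain ⟨z, hz⟩ : ∃ z : Subgroup.center (G ⧸ U), orderOf z = p := by
      obtain ⟨n, hn, hZ⟩ := (hpg.to_subgroup (Subgroup.center (G ⧸ U))).nontrivial_iff_card.1 hcnt
      exact exists_prime_orderOf_dvd_card' p (hZ ▸ dvd_pow_self p hn.ne')
    let π := QuotientGroup.mk' U
    have hπ : ∀ y : G, π y = 1 → y ∈ U := fun y hy => (QuotientGroup.eq_one_iff y).1 hy
    let Z : Subgroup (G ⧸ U) := Subgroup.zpowers (z : G ⧸ U)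
    have hZc : Z ≤ Subgroup.center (G ⧸ U) := (Subgroup.zpowers_le).2 z.2
    have hZn : Z.Normal := ⟨fun a ha g => by
      rwa [(Subgroup.mem_center_iff.1 (hZc ha) g), mul_inv_cancel_right]⟩
    have hVo : IsOpen ((Z.comap π : Subgroup G) : Set G) :=
      Subgroup.isOpen_mono (fun x hx => by
        have h1 : π x = 1 := (QuotientGroup.eq_one_iff x).2 hx
        rw [Subgroup.mem_comap, h1]
        exact one_mem Z) hUo
    have hVi : (Z.comap π).index = p ^ k := by
      rw [Subgroup.index_comap_of_surjective Z (QuotientGroup.mk'_surjective U)]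
      have h1 := Z.card_mul_index
      rw [Nat.card_zpowers, Subgroup.orderOf_coe, hz, hcard, pow_succ'] at h1
      exact Nat.eq_of_mul_eq_mul_left hp.pos h1
    obtain ⟨i, hi⟩ := ih (Z.comap π) hVo hVi
    refine ⟨i + 1, lowerPSeries_succ_le (U.isClosed_of_isOpen hUo) (fun x hx => hπ _ ?_)
      fun x hx g => hπ _ ?_⟩
    · obtain ⟨m, hm⟩ := Subgroup.mem_zpowers_iff.1 (hi hx)
      rw [map_pow, ← hm, ← zpow_natCast, ← zpow_mul, mul_comm, zpow_mul, zpow_natCast,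
        ← Subgroup.coe_pow, ← hz, pow_orderOf_eq_one, Subgroup.coe_one, one_zpow]
    · rw [map_commutatorElement, commutatorElement_eq_one_iff_mul_comm]
      exact (Subgroup.mem_center_iff.1 (hZc (hi hx)) _).symm

/-- Cauchy sequences with respect to the lower `p`-series converge in a compact group. -/
theorem exists_forall_mk_lowerPSeries_eq [CompactSpace G] {s : ℕ → G}
    (h : ∀ n, (s (n + 1) : G ⧸ lowerPSeries p G n) = s n) :
    ∃ z : G, ∀ n, (z : G ⧸ lowerPSeries p G n) = s n := by
  let t : ℕ → Set G := fun n => {z | (z : G ⧸ lowerPSeries p G n) = s n}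
  have ht : ∀ n, IsClosed (t n) := fun n => by
    have : t n = (fun z => z⁻¹ * s n) ⁻¹' (lowerPSeries p G n : Set G) := by
      ext z
      exact QuotientGroup.eq
    rw [this]
    exact (isClosed_lowerPSeries n).preimage (by fun_prop)
  have hanti : ∀ n, t (n + 1) ⊆ t n := fun n z hz => by
    have hz' : z⁻¹ * s (n + 1) ∈ lowerPSeries p G (n + 1) := QuotientGroup.eq.1 hz
    exact (QuotientGroup.eq.2 (lowerPSeries_antitone n.le_succ hz')).trans (h n)
  obtain ⟨z, hz⟩ := IsCompact.nonempty_iInter_of_sequence_nonempty_isCompact_isClosed t hanti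
    (fun n => ⟨s n, rfl⟩) (ht 0).isCompact ht
  exact ⟨z, fun n => Set.mem_iInter.1 hz n⟩

namespace IsUniformlyPowerful

variable [Fact p.Prime]

theorem isOpen_lowerPSeries (hG : IsUniformlyPowerful p G) (i : ℕ) :
    IsOpen (lowerPSeries p G i : Set G) := by
  have : (lowerPSeries p G i).FiniteIndex := by
    refine ⟨?_⟩
    have h1 := index_lowerPSeries_one_ne_zero (Fact.out : p.Prime).pos hG.isTopFG
    induction i with
    | zero => simp [lowerPSeries]
    | succ i ih =>
      rw [← Subgroup.relIndex_mul_index (lowerPSeries_antitone i.le_succ), hG.relIndex_eq]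
      exact mul_ne_zero h1 ih
  exact Subgroup.isOpen_of_isClosed_of_finiteIndex _ (isClosed_lowerPSeries i)

theorem hasBasis_nhds_one (hG : IsUniformlyPowerful p G) :
    (𝓝 (1 : G)).HasBasis (fun _ : ℕ => True) fun i => (lowerPSeries p G i : Set G) := by
  have := hG.isProP.compact
  have := hG.isProP.totallyDisconnected
  refine ⟨fun t => ⟨fun ht => ?_, fun ⟨i, _, hi⟩ => ?_⟩⟩
  · obtain ⟨V, hVt, hVo, h1⟩ := mem_nhds_iff.1 ht
    obtain ⟨U, hU⟩ := ProfiniteGrp.exist_openNormalSubgroup_sub_open_nhds_of_one hVo h1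
    obtain ⟨i, hi⟩ := exists_lowerPSeries_le hG.isProP U.toSubgroup U.isOpen'
    exact ⟨i, trivial, fun x hx => hVt (hU (hi hx))⟩
  · exact Filter.mem_of_superset ((hG.isOpen_lowerPSeries i).mem_nhds (one_mem _)) hi

theorem tendsto_of_mk_eq (hG : IsUniformlyPowerful p G) {s : ℕ → G} {z : G}
    (h : ∀ n, (z : G ⧸ lowerPSeries p G n) = s n) : Tendsto s atTop (𝓝 z) := by
  have h1 : Tendsto (fun n => z⁻¹ * s n) atTop (𝓝 1) := by
    refine hG.hasBasis_nhds_one.tendsto_right_iff.2 fun i _ => ?_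
    filter_upwards [eventually_ge_atTop i] with n hn
    exact lowerPSeries_antitone hn (QuotientGroup.eq.1 (h n))
  simpa using h1.const_mul z

theorem mem_of_isClosed (hG : IsUniformlyPowerful p G) {X : Set G} (hX : IsClosed X) {y : G}
    (h : ∀ n, ∃ x ∈ X, (y : G ⧸ lowerPSeries p G n) = x) : y ∈ X := by
  choose s hs hy using h
  exact hX.mem_of_tendsto (hG.tendsto_of_mk_eq hy) (Eventually.of_forall hs)

theorem eq_of_forall_mk_eq (hG : IsUniformlyPowerful p G) {x y : G}
    (h : ∀ n, (x : G ⧸ lowerPSeries p G n) = y) : x = y := by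
  have := hG.isProP.t2
  exact hG.mem_of_isClosed (isClosed_singleton (x := y)) fun n => ⟨y, rfl, h n⟩

end IsUniformlyPowerful

end Topology

/-! ### The power maps between terms of the lower `p`-series -/

section PowerMap

variable {p : ℕ} {G : Type*} [Group G] [TopologicalSpace G] [IsTopologicalGroup G] [Fact p.Prime]

/-- In a powerful group, the `p`-th power map as a homomorphism from the `i`-th term of the lower
`p`-series to the group modulo the term of index `i + 2`; its values come from the term of index
`i + 1`. -/
def lowerPSeriesPowHom (h : IsPowerful p G) (i : ℕ) :
    lowerPSeries p G i →* G ⧸ lowerPSeries p G (i + 2) where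
  toFun x := (((x : G) ^ p : G) : G ⧸ lowerPSeries p G (i + 2))
  map_one' := by simp
  map_mul' x y := mk_mul_pow_eq Fact.out h y.2 (x : G)

namespace IsUniformlyPowerful

/-- Every element of a term of the lower `p`-series is, modulo the next term, a `p`-th power of an
element of the preceding term. For the first factor this is powerfulness; commutators in the later
terms are rewritten by `[b ^ p, g] ≡ [b, g] ^ p`. -/
theorem lowerPSeries_succ_le_range (hG : IsUniformlyPowerful p G) (i : ℕ) :
    lowerPSeries p G (i + 1) ≤ (lowerPSeriesPowHom hG.isPowerful i).range.comap
      (QuotientGroup.mk' (lowerPSeries p G (i + 2))) := by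
  have hclosed : ∀ i, IsClosed (((lowerPSeriesPowHom hG.isPowerful i).range.comap
      (QuotientGroup.mk' (lowerPSeries p G (i + 2))) : Subgroup G) : Set G) := fun i =>
    Subgroup.isClosed_of_isOpen _ <| Subgroup.isOpen_mono (fun x hx => by
      have h1 : QuotientGroup.mk' (lowerPSeries p G (i + 2)) x = 1 :=
        (QuotientGroup.eq_one_iff x).2 hx
      rw [Subgroup.mem_comap, h1]
      exact one_mem _) (hG.isOpen_lowerPSeries (i + 2))
  have hpow : ∀ i, ∀ x ∈ lowerPSeries p G i, x ^ p ∈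
      (lowerPSeriesPowHom hG.isPowerful i).range.comap
      (QuotientGroup.mk' (lowerPSeries p G (i + 2))) := fun i x hx => ⟨⟨x, hx⟩, rfl⟩
  induction i with
  | zero =>
    refine lowerPSeries_succ_le (hclosed 0) (hpow 0) fun x _ g => ?_
    refine Subgroup.topologicalClosure_minimal _ ?_ (hclosed 0) (hG.isPowerful
      (Subgroup.commutator_mem_commutator (Subgroup.mem_top x) (Subgroup.mem_top g)))
    rw [Subgroup.powers, Subgroup.closure_le]
    rintro _ ⟨y, -, rfl⟩
    by_cases hp : p = 2
    · have h4 : y ^ 4 = (y ^ 2) ^ p := by rw [hp, ← pow_mul]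
      simp only [if_pos hp, h4]
      exact hpow 0 _ (Subgroup.mem_top _)
    · simp only [if_neg hp]
      exact hpow 0 _ (Subgroup.mem_top _)
  | succ i ih =>
    refine lowerPSeries_succ_le (hclosed _) (hpow _) fun x hx g => ?_
    obtain ⟨⟨b, hb⟩, hbx⟩ := ih hx
    obtain ⟨d, hd, rfl⟩ : ∃ d ∈ lowerPSeries p G (i + 2), x = b ^ p * d :=
      ⟨(b ^ p)⁻¹ * x, QuotientGroup.eq.1 hbx, by simp⟩
    have hc : ⁅b, g⁆ ∈ lowerPSeries p G (i + 1) := commutator_mem_lowerPSeries_succ hb g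
    refine ⟨⟨⁅b, g⁆, hc⟩, ?_⟩
    have h1 : ⁅b ^ p * d, g⁆ = b ^ p * ⁅d, g⁆ * (b ^ p)⁻¹ * ⁅b ^ p, g⁆ := by
      simp [commutatorElement_def, mul_assoc]
    have h2 : ((b ^ p * ⁅d, g⁆ * (b ^ p)⁻¹ : G) : G ⧸ lowerPSeries p G (i + 1 + 2)) = 1 :=
      (QuotientGroup.eq_one_iff _).2 ((lowerPSeries_normal _).conj_mem _
        (commutator_mem_lowerPSeries_succ hd g) _)
    have h3 : ⁅b ^ p, g⁆ = b ^ p * (b⁻¹ * ⁅b, g⁆) ^ p := by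
      have : b⁻¹ * ⁅b, g⁆ = g * b⁻¹ * g⁻¹ := by simp [commutatorElement_def, mul_assoc]
      rw [this, conj_pow]
      simp [commutatorElement_def, mul_assoc]
    change ((⁅b, g⁆ ^ p : G) : G ⧸ lowerPSeries p G (i + 1 + 2)) = ((⁅b ^ p * d, g⁆ : G) : G ⧸ _)
    -- `[b ^ p d, g] ≡ [b ^ p, g] = b ^ p (b⁻¹ [b, g]) ^ p ≡ [b, g] ^ p` modulo the term of index
    -- `i + 3`.
    rw [h1, QuotientGroup.mk_mul, h2, one_mul, h3, QuotientGroup.mk_mul,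
      mk_mul_pow_eq Fact.out hG.isPowerful hc b⁻¹, ← QuotientGroup.mk_mul]
    simp

theorem exists_mk_pow_eq (hG : IsUniformlyPowerful p G) {i : ℕ} {y : G}
    (hy : y ∈ lowerPSeries p G (i + 1)) :
    ∃ x ∈ lowerPSeries p G i, ((x ^ p : G) : G ⧸ lowerPSeries p G (i + 2)) = y := by
  obtain ⟨⟨x, hx⟩, hxy⟩ := hG.lowerPSeries_succ_le_range i hy
  exact ⟨x, hx, hxy⟩

/-- The `p`-th power map is injective on the factors of the lower `p`-series, being surjective
between finite sets of the same size. -/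
theorem mem_lowerPSeries_succ_of_pow_mem (hG : IsUniformlyPowerful p G) {i : ℕ} {x : G}
    (hx : x ∈ lowerPSeries p G i) (hxp : x ^ p ∈ lowerPSeries p G (i + 2)) :
    x ∈ lowerPSeries p G (i + 1) := by
  let f := lowerPSeriesPowHom hG.isPowerful i
  have hrange : f.range =
      (lowerPSeries p G (i + 1)).map (QuotientGroup.mk' (lowerPSeries p G (i + 2))) := by
    refine le_antisymm ?_ (Subgroup.map_le_iff_le_comap.2 (hG.lowerPSeries_succ_le_range i))
    rintro _ ⟨y, rfl⟩
    exact ⟨_, pow_mem_lowerPSeries_succ y.2, rfl⟩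
  have hle : (lowerPSeries p G (i + 1)).subgroupOf (lowerPSeries p G i) ≤ f.ker := fun y hy =>
    (QuotientGroup.eq_one_iff _).2 (pow_mem_lowerPSeries_succ (Subgroup.mem_subgroupOf.1 hy))
  have hker : f.ker.index = (lowerPSeries p G 1).index := by
    rw [Subgroup.index_ker, hrange, ← Subgroup.relIndex_ker, QuotientGroup.ker_mk', hG.relIndex_eq]
  have h1 := Subgroup.relIndex_mul_index hle
  rw [hker, ← Subgroup.relIndex, hG.relIndex_eq] at h1
  have h2 := Nat.eq_of_mul_eq_mul_right (Nat.pos_of_ne_zero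
    (index_lowerPSeries_one_ne_zero (Fact.out : p.Prime).pos hG.isTopFG))
    (h1.trans (one_mul _).symm)
  exact Subgroup.relIndex_eq_one.1 h2 (x := ⟨x, hx⟩) ((QuotientGroup.eq_one_iff _).2 hxp)

theorem mk_pow_eq_iff (hG : IsUniformlyPowerful p G) {k : ℕ} {x y : G} :
    ((x ^ p : G) : G ⧸ lowerPSeries p G (k + 1)) = (y ^ p : G) ↔
      (x : G ⧸ lowerPSeries p G k) = y := by
  have hy : y = x * (x⁻¹ * y) := by simp
  constructor
  · intro h
    induction k with
    | zero => exact QuotientGroup.eq.2 (Subgroup.mem_top _)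
    | succ k ih =>
      have hc : x⁻¹ * y ∈ lowerPSeries p G k := QuotientGroup.eq.1 <| ih <|
        QuotientGroup.eq.2 (lowerPSeries_antitone (k + 1).le_succ (QuotientGroup.eq.1 h))
      rw [hy, mk_mul_pow_eq Fact.out hG.isPowerful hc, QuotientGroup.mk_mul, left_eq_mul,
        QuotientGroup.eq_one_iff] at h
      exact QuotientGroup.eq.2 (hG.mem_lowerPSeries_succ_of_pow_mem hc h)
  · intro h
    have hc := QuotientGroup.eq.1 h
    have h1 := lowerPSeries_antitone (k + 1).le_succ
      (QuotientGroup.eq.1 (mk_mul_pow_eq Fact.out hG.isPowerful hc x).symm)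
    rw [← hy] at h1
    rw [← QuotientGroup.eq.2 h1, QuotientGroup.mk_mul,
      (QuotientGroup.eq_one_iff _).2 (pow_mem_lowerPSeries_succ hc), mul_one]

theorem mk_pow_pow_eq_iff (hG : IsUniformlyPowerful p G) {k n : ℕ} {x y : G} :
    ((x ^ p ^ n : G) : G ⧸ lowerPSeries p G (k + n)) = (y ^ p ^ n : G) ↔
      (x : G ⧸ lowerPSeries p G k) = y := by
  induction n with
  | zero => simp
  | succ n ih => rw [pow_succ, pow_mul, pow_mul, ← add_assoc, hG.mk_pow_eq_iff, ih]

theorem pow_pow_injective (hG : IsUniformlyPowerful p G) (n : ℕ) :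
    Function.Injective fun x : G => x ^ p ^ n := fun x y h =>
  hG.eq_of_forall_mk_eq fun k => (hG.mk_pow_pow_eq_iff (n := n)).1 <| by
    simp only at h
    rw [h]

theorem exists_pow_eq (hG : IsUniformlyPowerful p G) {n : ℕ} {y : G}
    (hy : y ∈ lowerPSeries p G (n + 1)) : ∃ x ∈ lowerPSeries p G n, x ^ p = y := by
  have := hG.isProP.compact
  have := hG.isProP.t2
  -- Successive approximation: the error in one more factor is corrected by `c`.
  have happrox : ∀ k, ∃ x ∈ lowerPSeries p G n,
      ((x ^ p : G) : G ⧸ lowerPSeries p G (n + 1 + k)) = y := by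
    intro k
    induction k with
    | zero =>
      exact ⟨1, one_mem _, QuotientGroup.eq.2 (by simpa using hy)⟩
    | succ k ih =>
      obtain ⟨x, hx, hxy⟩ := ih
      rw [show n + 1 + k = n + k + 1 by omega] at hxy
      obtain ⟨c, hc, hcy⟩ := hG.exists_mk_pow_eq (QuotientGroup.eq.1 hxy)
      refine ⟨x * c, mul_mem hx (lowerPSeries_antitone (Nat.le_add_right n k) hc), ?_⟩
      rw [show n + 1 + (k + 1) = n + k + 2 by omega, mk_mul_pow_eq Fact.out hG.isPowerful hc,
        QuotientGroup.mk_mul, hcy, ← QuotientGroup.mk_mul, mul_inv_cancel_left]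
  have hX : IsClosed ((fun x : G => x ^ p) '' (lowerPSeries p G n : Set G)) :=
    ((isClosed_lowerPSeries n).isCompact.image (continuous_pow p)).isClosed
  obtain ⟨x, hx, hxy⟩ := hG.mem_of_isClosed hX (y := y) fun k => by
    obtain ⟨x, hx, hxy⟩ := happrox k
    exact ⟨x ^ p, ⟨x, hx, rfl⟩, QuotientGroup.eq.2
      (lowerPSeries_antitone (Nat.le_add_left k (n + 1)) (QuotientGroup.eq.1 hxy.symm))⟩
  exact ⟨x, hx, hxy⟩

/-- The terms of the lower `p`-series are the sets of `p ^ n`-th powers, so they are preserved by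
every abstract automorphism. -/
theorem mem_lowerPSeries_iff (hG : IsUniformlyPowerful p G) {n : ℕ} {y : G} :
    y ∈ lowerPSeries p G n ↔ ∃ x, x ^ p ^ n = y := by
  refine ⟨fun hy => ?_, fun ⟨x, hx⟩ => hx ▸ pow_pow_mem_lowerPSeries x n⟩
  induction n generalizing y with
  | zero => exact ⟨y, by simp⟩
  | succ n ih =>
    obtain ⟨x, hx, rfl⟩ := hG.exists_pow_eq hy
    obtain ⟨w, rfl⟩ := ih hx
    exact ⟨w, by rw [pow_succ, pow_mul]⟩

theorem map_mem_lowerPSeries (hG : IsUniformlyPowerful p G) (α : G ≃* G) {n : ℕ} {y : G}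
    (hy : y ∈ lowerPSeries p G n) : α y ∈ lowerPSeries p G n := by
  obtain ⟨x, rfl⟩ := hG.mem_lowerPSeries_iff.1 hy
  exact hG.mem_lowerPSeries_iff.2 ⟨α x, (map_pow α x _).symm⟩

end IsUniformlyPowerful

end PowerMap

/-! ### The additive structure -/

section Sum

variable {p : ℕ} {G : Type*} [Group G] [TopologicalSpace G] [IsTopologicalGroup G]

/-- `z` is the sum of `x` and `y` in the additive structure, expressed without roots and limits:
`z ^ (p ^ n)` and `x ^ (p ^ n) * y ^ (p ^ n)` agree modulo `P_{2n+1}(G)` for every `n`. These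
elements lie in `P_{n+1}(G)`, in which commutators lie in `P_{2n+2}(G)`, so the conditions say that
addition is multiplication of `p ^ n`-th powers to within an error that `p ^ n`-th roots turn into
an element of `P_{n+1}(G)`. -/
def IsPowerSum (p : ℕ) (x y z : G) : Prop :=
  ∀ n : ℕ, ((z ^ p ^ n : G) : G ⧸ lowerPSeries p G (n + n)) = (x ^ p ^ n * y ^ p ^ n : G)

theorem IsPowerSum.comm {x y z : G} (h : IsPowerSum p x y z) : IsPowerSum p y x z := fun n => by
  rw [h n, QuotientGroup.mk_mul, QuotientGroup.mk_mul, ← commutatorElement_eq_one_iff_mul_comm]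
  exact (QuotientGroup.eq_one_iff _).2 (lowerPSeries_antitone (n + n).le_succ
    (commutator_mem_lowerPSeries_add (pow_pow_mem_lowerPSeries x n)
      (pow_pow_mem_lowerPSeries y n)))

theorem isPowerSum_one_left (x : G) : IsPowerSum p 1 x x := fun n => by simp

theorem isPowerSum_inv_left (x : G) : IsPowerSum p x⁻¹ x 1 := fun n => by simp

namespace IsUniformlyPowerful

variable [Fact p.Prime]

theorem isPowerSum_unique (hG : IsUniformlyPowerful p G) {x y z w : G}
    (hz : IsPowerSum p x y z) (hw : IsPowerSum p x y w) : z = w :=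
  hG.eq_of_forall_mk_eq fun n => (hG.mk_pow_pow_eq_iff (n := n)).1 ((hz n).trans (hw n).symm)

theorem exists_root_pow_mul_pow (hG : IsUniformlyPowerful p G) (x y : G) (n : ℕ) :
    ∃ s, s ^ p ^ n = x ^ p ^ n * y ^ p ^ n :=
  hG.mem_lowerPSeries_iff.1
    (mul_mem (pow_pow_mem_lowerPSeries x n) (pow_pow_mem_lowerPSeries y n))

/-- The roots `(x ^ (p ^ n) * y ^ (p ^ n)) ^ (p ^ (-n))` form a Cauchy sequence, because `p ^ n`-th
powers commute modulo `P_{2n+2}(G)`. -/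
theorem mk_root_succ_eq (hG : IsUniformlyPowerful p G) {x y : G} {s : ℕ → G}
    (hs : ∀ n, s n ^ p ^ n = x ^ p ^ n * y ^ p ^ n) (n : ℕ) :
    (s (n + 1) : G ⧸ lowerPSeries p G n) = s n := by
  have hcomm : Commute ((x ^ p ^ n : G) : G ⧸ lowerPSeries p G (n + (n + 1))) (y ^ p ^ n : G) :=
    commutatorElement_eq_one_iff_commute.1 ((QuotientGroup.eq_one_iff _).2
      (commutator_mem_lowerPSeries_add (pow_pow_mem_lowerPSeries x n)
        (pow_pow_mem_lowerPSeries y n)))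
  rw [← hG.mk_pow_pow_eq_iff (n := n + 1), hs, pow_succ p n, pow_mul, pow_mul, pow_mul, hs]
  simp only [QuotientGroup.mk_mul, QuotientGroup.mk_pow] at hcomm ⊢
  exact (hcomm.mul_pow p).symm

theorem isPowerSum_iff_mk_eq_root (hG : IsUniformlyPowerful p G) {x y z : G} {s : ℕ → G}
    (hs : ∀ n, s n ^ p ^ n = x ^ p ^ n * y ^ p ^ n) :
    IsPowerSum p x y z ↔ ∀ n, (z : G ⧸ lowerPSeries p G n) = s n :=
  forall_congr' fun n => by rw [← hs, hG.mk_pow_pow_eq_iff]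

theorem exists_isPowerSum (hG : IsUniformlyPowerful p G) (x y : G) : ∃ z, IsPowerSum p x y z := by
  have := hG.isProP.compact
  choose s hs using hG.exists_root_pow_mul_pow x y
  obtain ⟨z, hz⟩ := exists_forall_mk_lowerPSeries_eq (hG.mk_root_succ_eq hs)
  exact ⟨z, (hG.isPowerSum_iff_mk_eq_root hs).2 hz⟩

theorem isUniformSum_iff_isPowerSum (hG : IsUniformlyPowerful p G) {x y z : G} :
    IsUniformSum p x y z ↔ IsPowerSum p x y z := by
  have := hG.isProP.t2
  constructor
  · rintro ⟨s, hs, hlim⟩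
    have hs' : ∀ n, s n ^ p ^ n = x ^ p ^ n * y ^ p ^ n := fun n => (hs n (s n)).2 rfl
    obtain ⟨w, hw⟩ := hG.exists_isPowerSum x y
    have hlim' := hG.tendsto_of_mk_eq ((hG.isPowerSum_iff_mk_eq_root hs').1 hw)
    rwa [tendsto_nhds_unique hlim hlim']
  · intro h
    choose s hs using hG.exists_root_pow_mul_pow x y
    refine ⟨s, fun n w => ?_, hG.tendsto_of_mk_eq ((hG.isPowerSum_iff_mk_eq_root hs).1 h)⟩
    rw [← hs n]
    exact (hG.pow_pow_injective n).eq_iff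

theorem isPowerSum_assoc (hG : IsUniformlyPowerful p G) {x y z u v w w' : G}
    (hu : IsPowerSum p x y u) (hw : IsPowerSum p u z w) (hv : IsPowerSum p y z v)
    (hw' : IsPowerSum p x v w') : w = w' :=
  hG.isPowerSum_unique hw fun n => by
    rw [hw' n, QuotientGroup.mk_mul, hv n, QuotientGroup.mk_mul _ (u ^ p ^ n), hu n]
    simp only [QuotientGroup.mk_mul, mul_assoc]

/-- The additive structure of a uniformly powerful group. Its zero is `1` and its negation is the
inversion of the group. -/
@[reducible]
noncomputable def addCommGroup (hG : IsUniformlyPowerful p G) : AddCommGroup G :=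
  letI : Add G := ⟨fun x y => (hG.exists_isPowerSum x y).choose⟩
  letI : Zero G := ⟨1⟩
  letI : Neg G := ⟨fun x => x⁻¹⟩
  have hadd : ∀ x y : G, IsPowerSum p x y (x + y) := fun x y =>
    (hG.exists_isPowerSum x y).choose_spec
  { AddGroup.ofLeftAxioms
      (fun x y z : G => hG.isPowerSum_assoc (hadd x y) (hadd _ z) (hadd y z) (hadd x _))
      (fun x => hG.isPowerSum_unique (hadd 0 x) (isPowerSum_one_left x))
      (fun x => hG.isPowerSum_unique (hadd (-x) x) (isPowerSum_inv_left x)) with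
    add_comm := fun x y => hG.isPowerSum_unique (hadd x y) (hadd y x).comm }

theorem isUniformAdditiveStructure_addCommGroup (hG : IsUniformlyPowerful p G) :
    IsUniformAdditiveStructure p hG.addCommGroup := fun x y =>
  hG.isUniformSum_iff_isPowerSum.2 (hG.exists_isPowerSum x y).choose_spec

theorem eq_addCommGroup (hG : IsUniformlyPowerful p G) {A : AddCommGroup G}
    (hA : IsUniformAdditiveStructure p A) : A = hG.addCommGroup := by
  refine AddCommGroup.ext ?_
  funext x y
  exact hG.isPowerSum_unique (hG.isUniformSum_iff_isPowerSum.1 (hA x y))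
    (hG.exists_isPowerSum x y).choose_spec

/-! ### Automorphisms -/

theorem mk_map_eq_of_mk_eq (hG : IsUniformlyPowerful p G) (α : G ≃* G) {n : ℕ} {x y : G}
    (h : (x : G ⧸ lowerPSeries p G n) = y) : (α x : G ⧸ lowerPSeries p G n) = α y := by
  have := hG.map_mem_lowerPSeries α (QuotientGroup.eq.1 h)
  exact QuotientGroup.eq.2 (by simpa using this)

theorem isPowerSum_map (hG : IsUniformlyPowerful p G) (α : G ≃* G) {x y z : G}
    (h : IsPowerSum p x y z) : IsPowerSum p (α x) (α y) (α z) := fun n => by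
  simpa only [map_mul, map_pow] using hG.mk_map_eq_of_mk_eq α (h n)

/-- If the sequence `d` satisfies `d (i + 1) = -d i + α (d i)` in the additive structure, then
`d i ^ (p ^ n)` is, modulo `P_{2n+1}(G)`, the iterated commutator with `α` of `d 0 ^ (p ^ n)` in
the group. -/
theorem mk_iterComm_pow_eq (hG : IsUniformlyPowerful p G) (α : G ≃* G) {d : ℕ → G}
    (hd : ∀ i, IsPowerSum p (d i)⁻¹ (α (d i)) (d (i + 1))) (n i : ℕ) :
    ((d i ^ p ^ n : G) : G ⧸ lowerPSeries p G (n + n)) = α.iterComm i (d 0 ^ p ^ n) := by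
  induction i with
  | zero => rfl
  | succ i ih =>
    rw [hd i n, MulEquiv.iterComm, Function.iterate_succ_apply', ← MulEquiv.iterComm,
      QuotientGroup.mk_mul, QuotientGroup.mk_mul, inv_pow, ← map_pow, QuotientGroup.mk_inv,
      QuotientGroup.mk_inv, ih, hG.mk_map_eq_of_mk_eq α ih]

end IsUniformlyPowerful

end Sum

theorem mainTheorem9 (p : ℕ) [Fact p.Prime] (G : Type*) [Group G] [TopologicalSpace G]
    [IsTopologicalGroup G] (hG : IsUniformlyPowerful p G)
    (r : ℕ) (α : G ≃* G) (hα : α.IsUnipotent r) :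
    (∃! A : AddCommGroup G, IsUniformAdditiveStructure p A) ∧
    ∀ A : AddCommGroup G, IsUniformAdditiveStructure p A →
      ∃ β : G ≃+ G, (∀ g : G, β g = α g) ∧ β.IsUnipotent r := by
  refine ⟨⟨hG.addCommGroup, hG.isUniformAdditiveStructure_addCommGroup,
    fun A hA => hG.eq_addCommGroup hA⟩, fun A hA => ?_⟩
  obtain rfl := hG.eq_addCommGroup hA
  let _ := hG.addCommGroup
  have hadd : ∀ x y : G, IsPowerSum p x y (x + y) := fun x y =>
    hG.isUniformSum_iff_isPowerSum.1 (hA x y)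
  let β : G ≃+ G :=
    { toEquiv := α.toEquiv
      map_add' := fun x y =>
        hG.isPowerSum_unique (hG.isPowerSum_map α (hadd x y)) (hadd (α x) (α y)) }
  refine ⟨β, fun _ => rfl, fun g => ?_⟩
  have hd : ∀ i, IsPowerSum p (β.iterComm i g)⁻¹ (α (β.iterComm i g)) (β.iterComm (i + 1) g) := by
    intro i
    rw [AddEquiv.iterComm, AddEquiv.iterComm, Function.iterate_succ_apply']
    exact hadd _ _
  -- The `p ^ n`-th power of `[g,ᵣ β]` is trivial modulo `P_{2n+1}(G)`, hence `[g,ᵣ β]` is trivial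
  -- modulo `P_{n+1}(G)`, for every `n`.
  refine hG.eq_of_forall_mk_eq (y := 1) fun n => (hG.mk_pow_pow_eq_iff (n := n)).1 ?_
  have := hG.mk_iterComm_pow_eq α hd n r
  rw [this, hα, one_pow]
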